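/- Let $M$, $\Theta$, $X$ be compact smooth ($C^\infty$, finite-dimensional, Hausdorff, without boundary) manifolds, let $\pi : M \to \Theta$ be a smooth fibre bundle with typical fibre $X$, and let $f : M \to \mathbb{R}$ be a smooth function. A point $p \in M$ is a fibre-wise critical point of $f$ if $p$ is a critical point of the restriction of $f$ to the fibre $\pi^{-1}(\pi(p))$ through $p$; it is non-degenerate if the Hessian of that restriction at $p$ is non-singular. Assume that $f$ is fibre-wise Morse, i.e. that all its fibre-wise critical points are non-degenerate, and let $N \subset M$ be the set of fibre-wise critical points of $f$. Let $\gamma : [0,1] \to \Theta$ be a smooth path and let $p \in N \cap \pi^{-1}(\gamma(0))$. Then there is a unique path $\tilde\gamma : [0,1] \to N$ that is smooth (as a map into $M$) and satisfies $\tilde\gamma(0) = p$ and $\pi(\tilde\gamma(t)) = \gamma(t)$ for all $t \in [0,1]$. -/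

import Mathlib

open scoped Manifold ContDiff

noncomputable section

namespace FibreOpt

/-- `x` is a critical point of the real-valued function `h` on the manifold `X`. -/
def IsCriticalPoint {E H X : Type*} [NormedAddCommGroup E] [NormedSpace ℝ E] [TopologicalSpace H]
    (I : ModelWithCorners ℝ E H) [TopologicalSpace X] [ChartedSpace H X]
    (h : X → ℝ) (x : X) : Prop :=
  mfderiv I 𝓘(ℝ, ℝ) h x = 0

/-- The Hessian of `h` at `x`, as the bilinear form of second derivatives of `h` read in the
preferred chart at `x`. At a critical point of a smooth `h`, the form read in any other smooth
chart is congruent to this one, so non-degeneracy does not depend on the chart. -/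
def hessian {E H X : Type*} [NormedAddCommGroup E] [NormedSpace ℝ E] [TopologicalSpace H]
    (I : ModelWithCorners ℝ E H) [TopologicalSpace X] [ChartedSpace H X]
    (h : X → ℝ) (x : X) : E →L[ℝ] E →L[ℝ] ℝ :=
  fderiv ℝ (fderiv ℝ (h ∘ (extChartAt I x).symm)) (extChartAt I x x)

/-- The Hessian of `h` at `x` is non-singular. -/
def HasNonsingularHessian {E H X : Type*} [NormedAddCommGroup E] [NormedSpace ℝ E]
    [TopologicalSpace H] (I : ModelWithCorners ℝ E H) [TopologicalSpace X] [ChartedSpace H X]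
    (h : X → ℝ) (x : X) : Prop :=
  ∀ v : E, (∀ w : E, hessian I h x v w = 0) → v = 0

section Bundle

variable {EB HB B EX HX X EM HM M : Type*}
  [NormedAddCommGroup EB] [NormedSpace ℝ EB] [TopologicalSpace HB] (IB : ModelWithCorners ℝ EB HB)
  [TopologicalSpace B] [ChartedSpace HB B]
  [NormedAddCommGroup EX] [NormedSpace ℝ EX] [TopologicalSpace HX] (IX : ModelWithCorners ℝ EX HX)
  [TopologicalSpace X] [ChartedSpace HX X]
  [NormedAddCommGroup EM] [NormedSpace ℝ EM] [TopologicalSpace HM] (IM : ModelWithCorners ℝ EM HM)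
  [TopologicalSpace M] [ChartedSpace HM M]

/-- A local trivialization `π ⁻¹(U) ≃ U × X` (`U = e.baseSet` open, commuting with the projections
to `U`) is smooth if it and its inverse are smooth, i.e. if it is a diffeomorphism. -/
structure IsSmoothTrivialization {π : M → B} (e : Bundle.Trivialization X π) : Prop where
  smooth_toFun : ContMDiffOn IM (IB.prod IX) ∞ e e.source
  smooth_symm : ContMDiffOn (IB.prod IX) IM ∞ e.toOpenPartialHomeomorph.symm e.target

/-- `π : M → B` is a smooth fibre bundle with typical fibre `X`. -/
structure IsSmoothFibreBundle (X : Type*) [TopologicalSpace X] [ChartedSpace HX X]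
    (π : M → B) : Prop where
  smooth_proj : ContMDiff IM IB ∞ π
  exists_trivialization : ∀ b : B, ∃ e : Bundle.Trivialization X π,
    b ∈ e.baseSet ∧ IsSmoothTrivialization IB IX IM e

/-- The restriction of `f` to the fibre `π ⁻¹(b)`, where the fibre is identified with `X` through
the local trivialization `e` (for `b ∈ e.baseSet`). -/
def fibreRestriction {π : M → B} (e : Bundle.Trivialization X π) (f : M → ℝ) (b : B) : X → ℝ :=
  fun x => f (e.toOpenPartialHomeomorph.symm (b, x))

/-- `p` is a critical point of the restriction of `f` to the fibre through `p`. The smooth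
structure of the fibre is the one given by the smooth local trivializations; all of them around
`π p` induce the same one, so the condition holds for all of them if it holds for one. -/
def IsFibrewiseCriticalPoint (X : Type*) [TopologicalSpace X] [ChartedSpace HX X]
    (π : M → B) (f : M → ℝ) (p : M) : Prop :=
  ∀ e : Bundle.Trivialization X π, π p ∈ e.baseSet → IsSmoothTrivialization IB IX IM e →
    IsCriticalPoint IX (fibreRestriction e f (π p)) (e p).2

/-- The Hessian at `p` of the restriction of `f` to the fibre through `p` is non-singular. As
above, for a fibre-wise critical point `p` this does not depend on the local trivialization. -/
def IsFibrewiseNondegenerate (X : Type*) [TopologicalSpace X] [ChartedSpace HX X]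
    (π : M → B) (f : M → ℝ) (p : M) : Prop :=
  ∀ e : Bundle.Trivialization X π, π p ∈ e.baseSet → IsSmoothTrivialization IB IX IM e →
    HasNonsingularHessian IX (fibreRestriction e f (π p)) (e p).2

/-- The set `N` of fibre-wise critical points of `f`. -/
def fibrewiseCriticalSet (X : Type*) [TopologicalSpace X] [ChartedSpace HX X]
    (π : M → B) (f : M → ℝ) : Set M :=
  {p | IsFibrewiseCriticalPoint IB IX IM X π f p}

/-- `f` is a fibre-wise Morse function: all its fibre-wise critical points are non-degenerate. -/
def IsFibrewiseMorse (X : Type*) [TopologicalSpace X] [ChartedSpace HX X]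
    (π : M → B) (f : M → ℝ) : Prop :=
  ∀ p ∈ fibrewiseCriticalSet IB IX IM X π f, IsFibrewiseNondegenerate IB IX IM X π f p

end Bundle

end FibreOpt

end

open scoped Manifold ContDiff Topology
open Filter Set

namespace FibreOpt

/-! ### Critical points and charts -/

section CriticalPoint

variable {E H X E' H' X' : Type*}
  [NormedAddCommGroup E] [NormedSpace ℝ E] [TopologicalSpace H] {I : ModelWithCorners ℝ E H}
  [TopologicalSpace X] [ChartedSpace H X]
  [NormedAddCommGroup E'] [NormedSpace ℝ E'] [TopologicalSpace H'] {I' : ModelWithCorners ℝ E' H'}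
  [TopologicalSpace X'] [ChartedSpace H' X']

/-! In a local trivialization and charts, `f` becomes `H (u, y)` with `u` on the base and `y` on the
fibre, and `N` becomes the zero set of `G = ∂H/∂y`. At a point of `N`, the `y`-derivative of `G` is
the fibre Hessian, invertible by the Morse condition, so the implicit function theorem makes `N`
locally the graph of a function of `u` (`exists_local_section_fibrewiseCriticalSet`). Hence `N → B`
is a local homeomorphism.

As `N` is closed in the compact `M`, it is compact, and a local homeomorphism from a compact
Hausdorff space to a Hausdorff space is a covering map. So `γ` has exactly one continuous lift to
`N` starting at `p`. Near each time this lift is `γ` followed by a local section of `N`, hence it is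
smooth. -/

theorem IsCriticalPoint.comp {h : X → ℝ} {g : X' → X} {x : X'}
    (hc : IsCriticalPoint I h (g x)) (hh : MDifferentiableAt I 𝓘(ℝ, ℝ) h (g x))
    (hg : MDifferentiableAt I' I g x) : IsCriticalPoint I' (h ∘ g) x := by
  unfold IsCriticalPoint at *
  rw [mfderiv_comp x hh hg, hc]
  ext v
  rfl

theorem isCriticalPoint_congr {h h' : X → ℝ} {x : X} (hh : h =ᶠ[𝓝 x] h') :
    IsCriticalPoint I h x ↔ IsCriticalPoint I h' x := by
  unfold IsCriticalPoint
  rw [hh.mfderiv_eq]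
  rfl

/-- Being a critical point can be tested in any chart around the point. -/
theorem isCriticalPoint_iff_fderiv_extChartAt [I.Boundaryless] [IsManifold I ∞ X]
    {h : X → ℝ} {x₀ x : X} (hx : x ∈ (extChartAt I x₀).source)
    (hh : MDifferentiableAt I 𝓘(ℝ, ℝ) h x) :
    IsCriticalPoint I h x ↔
      fderiv ℝ (h ∘ (extChartAt I x₀).symm) (extChartAt I x₀ x) = 0 := by
  have hinv : (extChartAt I x₀).symm (extChartAt I x₀ x) = x := (extChartAt I x₀).left_inv hx
  have hsymm : MDifferentiableAt 𝓘(ℝ, E) I (extChartAt I x₀).symm (extChartAt I x₀ x) :=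
    ((contMDiffOn_extChartAt_symm (n := ∞) x₀).contMDiffAt
      ((isOpen_extChartAt_target x₀).mem_nhds ((extChartAt I x₀).map_source hx))).mdifferentiableAt
      (by simp)
  have hchart : MDifferentiableAt I 𝓘(ℝ, E) (extChartAt I x₀) x :=
    (contMDiffAt_extChartAt' (n := ∞) (by simpa using hx)).mdifferentiableAt (by simp)
  rw [← mfderiv_eq_fderiv]
  change _ ↔ IsCriticalPoint 𝓘(ℝ, E) (h ∘ (extChartAt I x₀).symm) (extChartAt I x₀ x)
  constructor
  · intro hc
    exact IsCriticalPoint.comp (by rwa [hinv]) (by rwa [hinv]) hsymm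
  · intro hc
    have hev : (h ∘ (extChartAt I x₀).symm) ∘ extChartAt I x₀ =ᶠ[𝓝 x] h := by
      filter_upwards [(isOpen_extChartAt_source x₀).mem_nhds hx] with z hz
      exact congrArg h ((extChartAt I x₀).left_inv hz)
    refine (isCriticalPoint_congr hev).1 (hc.comp ?_ hchart)
    exact MDifferentiableAt.comp _ (by rwa [hinv]) hsymm

end CriticalPoint

/-! ### Implicit function theorem for critical points -/

section ImplicitFunction

variable {E F : Type*} [NormedAddCommGroup E] [NormedSpace ℝ E]
  [NormedAddCommGroup F] [NormedSpace ℝ F]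

theorem contDiffAt_fderiv_partial {H : E × F → ℝ} {u₀ : E} {y₀ : F}
    (hH : ContDiffAt ℝ ∞ H (u₀, y₀)) :
    ContDiffAt ℝ ∞ (fun v : E × F => fderiv ℝ (fun y => H (v.1, y)) v.2) (u₀, y₀) := by
  refine ContDiffAt.fderiv (f := fun (v : E × F) y => H (v.1, y)) (g := Prod.snd) (n := ∞)
    ?_ contDiffAt_snd (by simp)
  exact ContDiffAt.comp (g := H) (f := fun p : (E × F) × F => (p.1.1, p.2)) _ hH (by fun_prop)

/-- Near a non-degenerate critical point of `y ↦ H (u₀, y)`, the critical points of the functions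
`y ↦ H (u, y)` form the graph of a smooth function of `u`. -/
theorem exists_contDiffAt_partial_critical [FiniteDimensional ℝ E] [FiniteDimensional ℝ F]
    {H : E × F → ℝ} {u₀ : E} {y₀ : F} (hH : ContDiffAt ℝ ∞ H (u₀, y₀))
    (hcrit : fderiv ℝ (fun y => H (u₀, y)) y₀ = 0)
    (hnd : ∀ v, (∀ w, fderiv ℝ (fderiv ℝ (fun y => H (u₀, y))) y₀ v w = 0) → v = 0) :
    ∃ g : E → F, ContDiffAt ℝ ∞ g u₀ ∧ g u₀ = y₀ ∧
      (∀ᶠ u in 𝓝 u₀, fderiv ℝ (fun y => H (u, y)) (g u) = 0) ∧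
      ∀ᶠ v in 𝓝 (u₀, y₀), fderiv ℝ (fun y => H (v.1, y)) v.2 = 0 → g v.1 = v.2 := by
  have : CompleteSpace E := FiniteDimensional.complete ℝ E
  have : CompleteSpace F := FiniteDimensional.complete ℝ F
  set G : E × F → (F →L[ℝ] ℝ) := fun v => fderiv ℝ (fun y => H (v.1, y)) v.2 with hG
  have hGsmooth : ContDiffAt ℝ ∞ G (u₀, y₀) := contDiffAt_fderiv_partial hH
  -- The partial derivative to be inverted is the Hessian in the `y` variable.
  have hpart : fderiv ℝ G (u₀, y₀) ∘L .inr ℝ E F =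
      fderiv ℝ (fderiv ℝ (fun y => H (u₀, y))) y₀ := by
    have h1 : HasFDerivAt G (fderiv ℝ G (u₀, y₀)) (u₀, y₀) :=
      (hGsmooth.differentiableAt (by simp)).hasFDerivAt
    exact (h1.comp y₀ (hasFDerivAt_prodMk_right u₀ y₀)).fderiv.symm
  have hinv : (fderiv ℝ G (u₀, y₀) ∘L .inr ℝ E F).IsInvertible := by
    rw [hpart]
    set A := fderiv ℝ (fderiv ℝ (fun y => H (u₀, y))) y₀
    have hinj : Function.Injective (A : F →ₗ[ℝ] F →L[ℝ] ℝ) := by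
      rw [← LinearMap.ker_eq_bot, LinearMap.ker_eq_bot']
      intro v hv
      refine hnd v fun w => ?_
      rw [show A v = 0 from hv]
      rfl
    -- Non-degeneracy only gives injectivity; equal finite dimensions upgrade it to invertibility.
    have hdim : Module.finrank ℝ F = Module.finrank ℝ (F →L[ℝ] ℝ) := by
      rw [← (LinearMap.toContinuousLinearMap (𝕜 := ℝ) (E := F) (F' := ℝ)).finrank_eq]
      exact Subspace.dual_finrank_eq.symm
    exact ⟨(LinearEquiv.ofInjectiveOfFinrankEq _ hinj hdim).toContinuousLinearEquiv, by
      ext; rfl⟩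
  have hG0 : G (u₀, y₀) = 0 := hcrit
  refine ⟨hGsmooth.implicitFunction (by simp) hinv,
    hGsmooth.contDiffAt_implicitFunction (by simp) hinv,
    hGsmooth.implicitFunction_apply_self (by simp) hinv, ?_, ?_⟩
  · have := hGsmooth.eventually_apply_implicitFunction (by simp) hinv
    rwa [hG0] at this
  · filter_upwards [hGsmooth.eventually_apply_eq_iff_implicitFunction (by simp) hinv] with v hv h
    exact hv.1 (h.trans hG0.symm)

end ImplicitFunction

/-! ### The fibre-wise critical set and its projection -/

section Bundle

variable {EB HB B EX HX X EM HM M : Type*}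
  [NormedAddCommGroup EB] [NormedSpace ℝ EB] [TopologicalSpace HB] {IB : ModelWithCorners ℝ EB HB}
  [TopologicalSpace B] [ChartedSpace HB B]
  [NormedAddCommGroup EX] [NormedSpace ℝ EX] [TopologicalSpace HX] {IX : ModelWithCorners ℝ EX HX}
  [TopologicalSpace X] [ChartedSpace HX X]
  [NormedAddCommGroup EM] [NormedSpace ℝ EM] [TopologicalSpace HM] {IM : ModelWithCorners ℝ EM HM}
  [TopologicalSpace M] [ChartedSpace HM M] {π : M → B} {f : M → ℝ}

theorem IsSmoothTrivialization.contMDiffAt_symm {e : Bundle.Trivialization X π}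
    (he : IsSmoothTrivialization IB IX IM e) {b : B} (hb : b ∈ e.baseSet) (x : X) :
    ContMDiffAt (IB.prod IX) IM ∞ e.toOpenPartialHomeomorph.symm (b, x) :=
  he.smooth_symm.contMDiffAt (e.open_target.mem_nhds (by simpa [e.target_eq] using hb))

theorem IsSmoothTrivialization.contMDiff_fibreRestriction {e : Bundle.Trivialization X π}
    (he : IsSmoothTrivialization IB IX IM e) (hf : ContMDiff IM 𝓘(ℝ, ℝ) ∞ f)
    {b : B} (hb : b ∈ e.baseSet) :
    ContMDiff IX 𝓘(ℝ, ℝ) ∞ (fibreRestriction e f b) := fun x =>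
  hf.contMDiffAt.comp x ((he.contMDiffAt_symm hb x).comp x
    (contMDiffAt_const.prodMk contMDiffAt_id))

/-- Fibre-wise criticality can be tested in one smooth local trivialization. -/
theorem isFibrewiseCriticalPoint_iff {e : Bundle.Trivialization X π} {p : M}
    (hp : π p ∈ e.baseSet) (he : IsSmoothTrivialization IB IX IM e)
    (hf : ContMDiff IM 𝓘(ℝ, ℝ) ∞ f) :
    IsFibrewiseCriticalPoint IB IX IM X π f p ↔
      IsCriticalPoint IX (fibreRestriction e f (π p)) (e p).2 := by
  refine ⟨fun h => h e hp he, fun h e' hp' he' => ?_⟩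
  have hsymm : e'.toOpenPartialHomeomorph.symm (π p, (e' p).2) = p := by
    rw [e'.mk_proj_snd' hp']
    exact e'.left_inv (e'.mem_source.2 hp')
  -- `τ` is the transition map between the two identifications of the fibre with `X`; the chain rule
  -- along it transfers criticality.
  set τ : X → X := fun x => (e (e'.toOpenPartialHomeomorph.symm (π p, x))).2 with hτ
  have hτp : τ (e' p).2 = (e p).2 := by rw [hτ]; simp only [hsymm]
  have hτsmooth : ContMDiffAt IX IX ∞ τ (e' p).2 := by
    have h1 : ContMDiffAt IX IM ∞ (fun x => e'.toOpenPartialHomeomorph.symm (π p, x)) (e' p).2 :=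
      (he'.contMDiffAt_symm hp' (e' p).2).comp (e' p).2 (contMDiffAt_const.prodMk contMDiffAt_id)
    have h2 : ContMDiffAt IM (IB.prod IX) ∞ e
        (e'.toOpenPartialHomeomorph.symm (π p, (e' p).2)) := by
      rw [hsymm]
      exact he.smooth_toFun.contMDiffAt (e.open_source.mem_nhds (e.mem_source.2 hp))
    exact contMDiffAt_snd.comp _ (h2.comp (e' p).2 h1)
  have hfib : fibreRestriction e' f (π p) = fibreRestriction e f (π p) ∘ τ := by
    funext x
    have hmem : e'.toOpenPartialHomeomorph.symm (π p, x) ∈ e.source := by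
      rw [e.mem_source, e'.proj_symm_apply' hp']
      exact hp
    have h3 : (π p, τ x) = e (e'.toOpenPartialHomeomorph.symm (π p, x)) := by
      refine Prod.ext ?_ rfl
      rw [e.coe_fst hmem, e'.proj_symm_apply' hp']
    simp only [fibreRestriction, Function.comp_apply]
    rw [h3]
    exact congrArg f (e.left_inv hmem).symm
  rw [hfib]
  refine IsCriticalPoint.comp (I := IX) ?_ ?_ (hτsmooth.mdifferentiableAt (by simp))
  · rwa [hτp]
  · exact (he.contMDiff_fibreRestriction hf hp).mdifferentiableAt (by simp)

variable (IB IX) in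
/-- The function `f` read in a local trivialization of the bundle, in the preferred charts of the
base at `b` and of the typical fibre at `x₀`. -/
noncomputable def localExpression (e : Bundle.Trivialization X π) (f : M → ℝ) (b : B) (x₀ : X) :
    EB × EX → ℝ :=
  fun v => f (e.toOpenPartialHomeomorph.symm
    ((extChartAt IB b).symm v.1, (extChartAt IX x₀).symm v.2))

theorem isFibrewiseNondegenerate_localExpression {e : Bundle.Trivialization X π} {q : M}
    (hq : π q ∈ e.baseSet) (he : IsSmoothTrivialization IB IX IM e)
    (hnd : IsFibrewiseNondegenerate IB IX IM X π f q) (v : EX)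
    (hv : ∀ w, fderiv ℝ (fderiv ℝ (fun y => localExpression IB IX e f (π q) (e q).2
      (extChartAt IB (π q) (π q), y))) (extChartAt IX (e q).2 (e q).2) v w = 0) : v = 0 := by
  refine hnd e hq he v fun w => ?_
  have h := hv w
  simp only [localExpression, extChartAt_to_inv] at h
  exact h

theorem IsSmoothTrivialization.continuousAt_snd {e : Bundle.Trivialization X π} {q : M}
    (he : IsSmoothTrivialization IB IX IM e) (hq : π q ∈ e.baseSet) :
    ContinuousAt (fun q' => (e q').2) q :=
  continuous_snd.continuousAt.comp
    (he.smooth_toFun.continuousOn.continuousAt (e.open_source.mem_nhds (e.mem_source.2 hq)))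

theorem IsSmoothTrivialization.continuousAt_coordinates {e : Bundle.Trivialization X π} {q : M}
    (he : IsSmoothTrivialization IB IX IM e) (hπ : Continuous π) (hq : π q ∈ e.baseSet) :
    ContinuousAt (fun q' => (extChartAt IB (π q) (π q'), extChartAt IX (e q).2 (e q').2)) q :=
  (ContinuousAt.comp (f := π) (continuousAt_extChartAt (π q)) hπ.continuousAt).prodMk
    (ContinuousAt.comp (f := fun q' => (e q').2) (g := extChartAt IX (e q).2)
      (continuousAt_extChartAt (e q).2) (he.continuousAt_snd hq))

theorem IsSmoothTrivialization.eventually_mem_chart_domains {e : Bundle.Trivialization X π} {q : M}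
    (he : IsSmoothTrivialization IB IX IM e) (hπ : Continuous π) (hq : π q ∈ e.baseSet) :
    ∀ᶠ q' in 𝓝 q, π q' ∈ e.baseSet ∧ π q' ∈ (extChartAt IB (π q)).source ∧
      (e q').2 ∈ (extChartAt IX (e q).2).source :=
  (hπ.continuousAt.eventually_mem (e.open_baseSet.mem_nhds hq)).and
    ((hπ.continuousAt.eventually_mem (extChartAt_source_mem_nhds (π q))).and
      ((he.continuousAt_snd hq).eventually_mem (extChartAt_source_mem_nhds (e q).2)))

variable [IX.Boundaryless] [IsManifold IX ∞ X]

/-- The charts are centred at fixed `b` and `x₀` while `p` varies, so one equation `G = 0` describes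
`N` on a whole neighbourhood. -/
theorem mem_fibrewiseCriticalSet_iff_localExpression {e : Bundle.Trivialization X π}
    (he : IsSmoothTrivialization IB IX IM e) (hf : ContMDiff IM 𝓘(ℝ, ℝ) ∞ f) {b : B} {x₀ : X}
    {p : M} (hp : π p ∈ e.baseSet) (hpb : π p ∈ (extChartAt IB b).source)
    (hpx : (e p).2 ∈ (extChartAt IX x₀).source) :
    p ∈ fibrewiseCriticalSet IB IX IM X π f ↔
      fderiv ℝ (fun y => localExpression IB IX e f b x₀ (extChartAt IB b (π p), y))
        (extChartAt IX x₀ (e p).2) = 0 := by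
  refine (isFibrewiseCriticalPoint_iff hp he hf).trans
    ((isCriticalPoint_iff_fderiv_extChartAt hpx
      ((he.contMDiff_fibreRestriction hf hp).mdifferentiableAt (by simp))).trans ?_)
  simp only [localExpression, (extChartAt IB b).left_inv hpb]
  rfl

variable [IB.Boundaryless] [IsManifold IB ∞ B]

theorem contDiffAt_localExpression {e : Bundle.Trivialization X π} {b : B} (hb : b ∈ e.baseSet)
    (he : IsSmoothTrivialization IB IX IM e) (hf : ContMDiff IM 𝓘(ℝ, ℝ) ∞ f) (x₀ : X) :
    ContDiffAt ℝ ∞ (localExpression IB IX e f b x₀) (extChartAt IB b b, extChartAt IX x₀ x₀) := by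
  have hψs : ContMDiffAt 𝓘(ℝ, EB) IB ∞ (extChartAt IB b).symm (extChartAt IB b b) :=
    (contMDiffOn_extChartAt_symm b).contMDiffAt (extChartAt_target_mem_nhds b)
  have hφs : ContMDiffAt 𝓘(ℝ, EX) IX ∞ (extChartAt IX x₀).symm (extChartAt IX x₀ x₀) :=
    (contMDiffOn_extChartAt_symm x₀).contMDiffAt (extChartAt_target_mem_nhds x₀)
  rw [← contMDiffAt_iff_contDiffAt]
  refine hf.contMDiffAt.comp _ (ContMDiffAt.comp (I' := IB.prod IX) _ ?_ ?_)
  · simp only [extChartAt_to_inv]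
    exact he.contMDiffAt_symm hb x₀
  · exact (ContMDiffAt.comp (f := Prod.fst) (extChartAt IB b b, extChartAt IX x₀ x₀) hψs
      contDiffAt_fst.contMDiffAt).prodMk
      (ContMDiffAt.comp (f := Prod.snd) (extChartAt IB b b, extChartAt IX x₀ x₀) hφs
        contDiffAt_snd.contMDiffAt)

/-- Off `N` the continuous `G` is nonzero, and stays so nearby. -/
theorem isClosed_fibrewiseCriticalSet (hπ : IsSmoothFibreBundle IB IX IM X π)
    (hf : ContMDiff IM 𝓘(ℝ, ℝ) ∞ f) : IsClosed (fibrewiseCriticalSet IB IX IM X π f) := by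
  rw [← isOpen_compl_iff, isOpen_iff_eventually]
  intro q hq
  obtain ⟨e, hqe, he⟩ := hπ.exists_trivialization (π q)
  have hπc := hπ.smooth_proj.continuous
  have hq0 := mt (mem_fibrewiseCriticalSet_iff_localExpression he hf hqe
    (mem_extChartAt_source (π q)) (mem_extChartAt_source (e q).2)).2 hq
  have hG := (contDiffAt_fderiv_partial
    (contDiffAt_localExpression hqe he hf (e q).2)).continuousAt
  filter_upwards [(he.continuousAt_coordinates hπc hqe).eventually (hG.eventually_ne hq0),
    he.eventually_mem_chart_domains hπc hqe] with q' hq' hdom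
  exact mt (mem_fibrewiseCriticalSet_iff_localExpression he hf hdom.1 hdom.2.1 hdom.2.2).1 hq'

/-- Near one of its points, the fibre-wise critical set of a fibre-wise Morse function is the image
of a section of `π` which is smooth at the point. -/
theorem exists_local_section_fibrewiseCriticalSet
    [FiniteDimensional ℝ EB] [FiniteDimensional ℝ EX] (hπ : IsSmoothFibreBundle IB IX IM X π)
    (hf : ContMDiff IM 𝓘(ℝ, ℝ) ∞ f) (hMorse : IsFibrewiseMorse IB IX IM X π f)
    {q : M} (hq : q ∈ fibrewiseCriticalSet IB IX IM X π f) :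
    ∃ s : B → M, ContMDiffAt IB IM ∞ s (π q) ∧ s (π q) = q ∧
      (∀ᶠ b in 𝓝 (π q), s b ∈ fibrewiseCriticalSet IB IX IM X π f ∧ π (s b) = b) ∧
      ∀ᶠ q' in 𝓝 q, q' ∈ fibrewiseCriticalSet IB IX IM X π f → s (π q') = q' := by
  obtain ⟨e, hqe, he⟩ := hπ.exists_trivialization (π q)
  have hπc := hπ.smooth_proj.continuous
  have hcrit := (mem_fibrewiseCriticalSet_iff_localExpression he hf hqe
    (mem_extChartAt_source (π q)) (mem_extChartAt_source (e q).2)).1 hq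
  obtain ⟨g, hg, hg₀, hgcrit, hguniq⟩ := exists_contDiffAt_partial_critical
    (contDiffAt_localExpression hqe he hf (e q).2) hcrit
    (isFibrewiseNondegenerate_localExpression hqe he (hMorse q hq))
  set ψ := extChartAt IB (π q)
  set φ := extChartAt IX (e q).2
  have hφs : ContMDiffAt 𝓘(ℝ, EX) IX ∞ φ.symm (g (ψ (π q))) := by
    rw [hg₀]
    exact (contMDiffOn_extChartAt_symm (e q).2).contMDiffAt (extChartAt_target_mem_nhds (e q).2)
  have hψc : ContMDiffAt IB 𝓘(ℝ, EB) ∞ ψ (π q) := contMDiffAt_extChartAt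
  have hgψ : ContMDiffAt IB 𝓘(ℝ, EX) ∞ (fun b => g (ψ b)) (π q) :=
    hg.contMDiffAt.comp (π q) hψc
  refine ⟨fun b => e.toOpenPartialHomeomorph.symm (b, φ.symm (g (ψ b))), ?_, ?_, ?_, ?_⟩
  · refine ContMDiffAt.comp (I' := IB.prod IX) (π q) (he.contMDiffAt_symm hqe _)
      (contMDiffAt_id.prodMk ?_)
    exact ContMDiffAt.comp (f := fun b => g (ψ b)) (π q) hφs hgψ
  · have hx : φ.symm (φ (e q).2) = (e q).2 := extChartAt_to_inv _
    simp only [hg₀, hx]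
    rw [e.mk_proj_snd' hqe]
    exact e.left_inv (e.mem_source.2 hqe)
  · have htarget : ∀ᶠ b in 𝓝 (π q), g (ψ b) ∈ φ.target := by
      refine hgψ.continuousAt.eventually_mem ?_
      rw [hg₀]
      exact extChartAt_target_mem_nhds (e q).2
    filter_upwards [e.open_baseSet.mem_nhds hqe, extChartAt_source_mem_nhds (I := IB) (π q),
      htarget, hψc.continuousAt.eventually hgcrit] with b hbe hbψ ht hc
    have hproj := e.proj_symm_apply' (x := φ.symm (g (ψ b))) hbe
    have hsnd : (e (e.toOpenPartialHomeomorph.symm (b, φ.symm (g (ψ b))))).2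
        = φ.symm (g (ψ b)) := by rw [e.apply_symm_apply' hbe]
    refine ⟨(mem_fibrewiseCriticalSet_iff_localExpression he hf (b := π q) (x₀ := (e q).2)
      (by rwa [hproj]) (by rwa [hproj]) (by rw [hsnd]; exact φ.map_target ht)).2 ?_, hproj⟩
    rw [hproj, hsnd]
    change fderiv ℝ _ (φ (φ.symm (g (ψ b)))) = 0
    rw [φ.right_inv ht]
    exact hc
  · filter_upwards [(he.continuousAt_coordinates hπc hqe).eventually hguniq,
      he.eventually_mem_chart_domains hπc hqe] with q' hq' hdom hmem
    have hgq : g (ψ (π q')) = φ (e q').2 := hq'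
      ((mem_fibrewiseCriticalSet_iff_localExpression he hf hdom.1 hdom.2.1 hdom.2.2).1 hmem)
    rw [hgq, φ.left_inv hdom.2.2, e.mk_proj_snd' hdom.1]
    exact e.left_inv (e.mem_source.2 hdom.1)

/-- The projection of the fibre-wise critical set of a fibre-wise Morse function is a local
homeomorphism. -/
theorem isLocalHomeomorph_proj_fibrewiseCriticalSet
    [FiniteDimensional ℝ EB] [FiniteDimensional ℝ EX] (hπ : IsSmoothFibreBundle IB IX IM X π)
    (hf : ContMDiff IM 𝓘(ℝ, ℝ) ∞ f) (hMorse : IsFibrewiseMorse IB IX IM X π f) :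
    IsLocalHomeomorph (fun q : fibrewiseCriticalSet IB IX IM X π f => π q) := by
  have hcont : Continuous (fun q : fibrewiseCriticalSet IB IX IM X π f => π q) :=
    hπ.smooth_proj.continuous.comp continuous_subtype_val
  have hopen : IsOpenMap (fun q : fibrewiseCriticalSet IB IX IM X π f => π q) := by
    refine isOpenMap_iff_nhds_le.2 fun q U hU => ?_
    obtain ⟨s, hs, hsq, hsec, -⟩ := exists_local_section_fibrewiseCriticalSet hπ hf hMorse q.2
    rw [mem_map, mem_nhds_subtype] at hU
    obtain ⟨V, hV, hVU⟩ := hU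
    -- Every `b` near `π q` is the image of `s b`, a point of `N` close to `q`.
    filter_upwards [hsec, hs.continuousAt.eventually_mem (by rwa [hsq])] with b hb hbV
    rw [← hb.2]
    exact hVU (a := ⟨s b, hb.1⟩) hbV
  refine isLocalHomeomorph_iff_isOpenEmbedding_restrict.2 fun q => ?_
  obtain ⟨s, -, -, -, huniq⟩ := exists_local_section_fibrewiseCriticalSet hπ hf hMorse q.2
  obtain ⟨U, hU, hUo, hqU⟩ := eventually_nhds_iff.1 huniq
  have hVo : IsOpen ((↑) ⁻¹' U : Set (fibrewiseCriticalSet IB IX IM X π f)) :=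
    hUo.preimage continuous_subtype_val
  refine ⟨_, hVo.mem_nhds hqU, .of_continuous_injective_isOpenMap
    (hcont.comp continuous_subtype_val) ?_ (hopen.comp hVo.isOpenMap_subtype_val)⟩
  -- On `U`, a point of `N` is recovered from its projection by `s`.
  rintro ⟨x, hx⟩ ⟨y, hy⟩ hxy
  have hxy' : π x = π y := hxy
  refine Subtype.ext (Subtype.ext ?_)
  rw [← hU x hx x.2, ← hU y hy y.2, hxy']

/-- A continuous lift of a smooth map to the fibre-wise critical set is smooth. -/
theorem contMDiff_lift_fibrewiseCriticalSet
    [FiniteDimensional ℝ EB] [FiniteDimensional ℝ EX] (hπ : IsSmoothFibreBundle IB IX IM X π)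
    (hf : ContMDiff IM 𝓘(ℝ, ℝ) ∞ f) (hMorse : IsFibrewiseMorse IB IX IM X π f)
    {E H T : Type*} [NormedAddCommGroup E] [NormedSpace ℝ E] [TopologicalSpace H]
    {I : ModelWithCorners ℝ E H} [TopologicalSpace T] [ChartedSpace H T]
    {Γ : T → fibrewiseCriticalSet IB IX IM X π f} (hΓ : Continuous Γ)
    (hsmooth : ContMDiff I IB ∞ (fun t => π (Γ t))) :
    ContMDiff I IM ∞ (fun t => (Γ t : M)) := by
  intro t
  obtain ⟨s, hs, -, -, huniq⟩ := exists_local_section_fibrewiseCriticalSet hπ hf hMorse (Γ t).2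
  have hcont : ContinuousAt (fun t => (Γ t : M)) t := (continuous_subtype_val.comp hΓ).continuousAt
  refine (ContMDiffAt.comp (g := s) t hs (hsmooth t)).congr_of_eventuallyEq ?_
  filter_upwards [hcont.eventually huniq] with t' ht'
  exact (ht' (Γ t').2).symm

end Bundle

end FibreOpt

theorem mainTheorem3
    {EB HB B EX HX X EM HM M : Type*}
    [NormedAddCommGroup EB] [NormedSpace ℝ EB] [FiniteDimensional ℝ EB]
    [TopologicalSpace HB] (IB : ModelWithCorners ℝ EB HB) [IB.Boundaryless]
    [TopologicalSpace B] [ChartedSpace HB B] [IsManifold IB ∞ B] [T2Space B] [CompactSpace B]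
    [NormedAddCommGroup EX] [NormedSpace ℝ EX] [FiniteDimensional ℝ EX]
    [TopologicalSpace HX] (IX : ModelWithCorners ℝ EX HX) [IX.Boundaryless]
    [TopologicalSpace X] [ChartedSpace HX X] [IsManifold IX ∞ X] [T2Space X] [CompactSpace X]
    [NormedAddCommGroup EM] [NormedSpace ℝ EM] [FiniteDimensional ℝ EM]
    [TopologicalSpace HM] (IM : ModelWithCorners ℝ EM HM) [IM.Boundaryless]
    [TopologicalSpace M] [ChartedSpace HM M] [IsManifold IM ∞ M] [T2Space M] [CompactSpace M]
    (π : M → B) (hπ : FibreOpt.IsSmoothFibreBundle IB IX IM X π)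
    (f : M → ℝ) (hf : ContMDiff IM 𝓘(ℝ, ℝ) ∞ f)
    (hMorse : FibreOpt.IsFibrewiseMorse IB IX IM X π f)
    (γ : unitInterval → B) (hγ : ContMDiff (𝓡∂ 1) IB ∞ γ)
    (p : FibreOpt.fibrewiseCriticalSet IB IX IM X π f) (hp : π p = γ 0) :
    ∃! γ' : unitInterval → FibreOpt.fibrewiseCriticalSet IB IX IM X π f,
      ContMDiff (𝓡∂ 1) IM ∞ (fun t => (γ' t : M)) ∧ γ' 0 = p ∧ ∀ t, π (γ' t) = γ t := by
  have hN := (FibreOpt.isClosed_fibrewiseCriticalSet hπ hf).isCompact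
  have : CompactSpace (FibreOpt.fibrewiseCriticalSet IB IX IM X π f) :=
    isCompact_iff_compactSpace.1 hN
  have hcov : IsCoveringMap (fun q : FibreOpt.fibrewiseCriticalSet IB IX IM X π f => π q) :=
    isLocalHomeomorph_iff_isCoveringMap.1
      (FibreOpt.isLocalHomeomorph_proj_fibrewiseCriticalSet hπ hf hMorse)
  set Γ := hcov.liftPath ⟨γ, hγ.continuous⟩ p hp.symm
  have hΓ : ∀ t, π (Γ t) = γ t := congrFun (hcov.liftPath_lifts ⟨γ, hγ.continuous⟩ p hp.symm)
  refine ⟨Γ, ⟨?_, hcov.liftPath_zero ⟨γ, hγ.continuous⟩ p hp.symm, hΓ⟩, ?_⟩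
  · refine FibreOpt.contMDiff_lift_fibrewiseCriticalSet hπ hf hMorse Γ.continuous ?_
    simpa only [hΓ] using hγ
  -- A smooth competitor is in particular a continuous lift into `N`, so uniqueness for coverings
  -- applies.
  · rintro Γ' ⟨hsmooth, h0, hlift⟩
    exact (hcov.eq_liftPath_iff hp.symm).2
      ⟨continuous_induced_rng.2 hsmooth.continuous, funext hlift, h0⟩
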